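/- Let $C[0,1]$ be the real Banach space of continuous functions $[0,1]\to\mathbb{R}$ with the supremum norm. A closed linear subspace $X$ of $C[0,1]$ is called C-rich if for every nonempty (relatively) open set $U\subseteq[0,1]$ and every $\varepsilon>0$ there is a nonnegative function $h\in C[0,1]$ with $\|h\|_\infty=1$, with support contained in $U$, and with $\operatorname{dist}(h,X)<\varepsilon$. Let $X$ be a C-rich closed subspace of $C[0,1]$, with the norm inherited from $C[0,1]$. Then $X$ is neither strictly convex nor smooth; that is: 1. $X$ is not strictly convex: not every point of the unit sphere of $X$ is an extreme point of the closed unit ball of $X$. 2. $X$ is not smooth: it is not true that for every $x\in X$ with $\|x\|=1$ there is exactly one $x^*\in X^*$ with $\|x^*\|=1$ and $x^*(x)=1$. -/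

import Mathlib

/-- A subspace `X` of the real space `C(K)`, `K` compact Hausdorff, is C-rich if for every nonempty
open `U ⊆ K` and every `ε > 0` there is a nonnegative `h ∈ C(K)` of sup norm `1`, with (closed)
support inside `U`, at distance less than `ε` from `X`. -/
def IsCRich {K : Type*} [TopologicalSpace K] [CompactSpace K] [T2Space K]
    (X : Submodule ℝ C(K, ℝ)) : Prop :=
  ∀ U : Set K, IsOpen U → U.Nonempty → ∀ ε : ℝ, 0 < ε →
    ∃ h : C(K, ℝ), 0 ≤ h ∧ ‖h‖ = 1 ∧ tsupport h ⊆ U ∧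
      Metric.infDist h (X : Set C(K, ℝ)) < ε

/-- A real normed space is smooth if every point of its unit sphere has exactly one supporting
functional of norm one. -/
def IsSmoothNormedSpace (E : Type*) [NormedAddCommGroup E] [NormedSpace ℝ E] : Prop :=
  ∀ x : E, ‖x‖ = 1 → ∃! f : StrongDual ℝ E, ‖f‖ = 1 ∧ f x = 1

/-! Strict convexity fails because two distinct elements of `X` can be pushed to norm one at
essentially the same point. Adding the same approximate bump, suitably scaled, to both brings them
closer to `1` at a new common point; the corrections form a geometric series, and in the limit the
norm of the sum is at least 2. If one element starts with an extra bump elsewhere, the limits stay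
distinct.

Smoothness would force `|y|` to agree at any two peak points of a nonzero `x ∈ X`, for every `y ∈
X`. On a segment joining two almost disjoint bumps, the intermediate value theorem gives an `x`
peaking on both halves `A` and `B`; testing with the bumps makes `x` too small at its own peak. -/

open Set Filter Topology

/-! ### Smoothness and peak points -/

/-- In a smooth space, two functionals of norm at most one that attain their norm at a common nonzero
vector agree up to sign. -/
theorem IsSmoothNormedSpace.abs_apply_eq {E : Type*} [NormedAddCommGroup E] [NormedSpace ℝ E]
    (hsm : IsSmoothNormedSpace E) {φ ψ : E →ₗ[ℝ] ℝ} {x : E} (hφ : ∀ z, |φ z| ≤ ‖z‖)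
    (hψ : ∀ z, |ψ z| ≤ ‖z‖) (hx0 : x ≠ 0) (hφx : |φ x| = ‖x‖) (hψx : |ψ x| = ‖x‖) (y : E) :
    |φ y| = |ψ y| := by
  have hpos : 0 < ‖x‖ := norm_pos_iff.2 hx0
  have hx₁ : ‖‖x‖⁻¹ • x‖ = 1 := by
    rw [norm_smul, norm_inv, norm_norm, inv_mul_cancel₀ hpos.ne']
  have supporting : ∀ θ : E →ₗ[ℝ] ℝ, (∀ z, |θ z| ≤ ‖z‖) → |θ x| = ‖x‖ →
      ∃ f : StrongDual ℝ E, (‖f‖ = 1 ∧ f (‖x‖⁻¹ • x) = 1) ∧ ∀ z, |f z| = |θ z| := by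
    intro θ hθ hθx
    -- Multiplying `θ` by the sign of `θ x` makes its value at the normalized `x` equal to `+1`.
    have hsign : |(SignType.sign (θ x) : ℝ)| = 1 := by
      rcases lt_trichotomy (θ x) 0 with h | h | h
      · simp [h]
      · rw [h, abs_zero] at hθx
        exact absurd hθx hpos.ne
      · simp [h]
    have hbound : ∀ z, ‖((SignType.sign (θ x) : ℝ) • θ) z‖ ≤ 1 * ‖z‖ := fun z => by
      rw [LinearMap.smul_apply, norm_smul, Real.norm_eq_abs, hsign, one_mul, one_mul]
      exact hθ z
    let f : StrongDual ℝ E := ((SignType.sign (θ x) : ℝ) • θ).mkContinuous 1 hbound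
    have hf : ∀ z, f z = SignType.sign (θ x) * θ z := fun z => rfl
    have hfx : f (‖x‖⁻¹ • x) = 1 := by
      rw [map_smul, hf, sign_mul_self, hθx, smul_eq_mul, inv_mul_cancel₀ hpos.ne']
    refine ⟨f, ⟨le_antisymm (LinearMap.mkContinuous_norm_le _ zero_le_one _) ?_, hfx⟩,
      fun z => by rw [hf, abs_mul, hsign, one_mul]⟩
    simpa [hfx, hx₁] using f.le_opNorm (‖x‖⁻¹ • x)
  obtain ⟨f, hf, hfφ⟩ := supporting φ hφ hφx
  obtain ⟨g, hg, hgψ⟩ := supporting ψ hψ hψx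
  rw [← hfφ, ← hgψ, (hsm _ hx₁).unique hf hg]

theorem abs_apply_eq_of_isSmoothNormedSpace {K : Type*} [TopologicalSpace K] [CompactSpace K]
    {X : Submodule ℝ C(K, ℝ)} (hsm : IsSmoothNormedSpace X) {x y : C(K, ℝ)} (hx : x ∈ X) (hy : y ∈ X) (hx0 : x ≠ 0) {s t : K} (hs : |x s| = ‖x‖) (ht : |x t| = ‖x‖) :
    |y s| = |y t| := by
  have hev : ∀ u, ∃ φ : X →ₗ[ℝ] ℝ, ∀ z, φ z = (z : C(K, ℝ)) u := fun u =>
    ⟨⟨⟨fun z => (z : C(K, ℝ)) u, fun _ _ => rfl⟩, fun _ _ => rfl⟩, fun _ => rfl⟩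
  obtain ⟨φ, hφ⟩ := hev s
  obtain ⟨ψ, hψ⟩ := hev t
  have := hsm.abs_apply_eq (φ := φ) (ψ := ψ) (x := ⟨x, hx⟩)
    (fun z => by rw [hφ]; exact (z : C(K, ℝ)).norm_coe_le_norm s)
    (fun z => by rw [hψ]; exact (z : C(K, ℝ)).norm_coe_le_norm t)
    (fun h => hx0 (congrArg Subtype.val h)) (by rw [hφ]; exact hs) (by rw [hψ]; exact ht) ⟨y, hy⟩
  rwa [hφ, hψ] at this

/-! ### Approximate bumps -/

section CRich

variable {K : Type*} [TopologicalSpace K] [CompactSpace K] [T2Space K]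
  {X : Submodule ℝ C(K, ℝ)}

theorem ContinuousMap.exists_abs_apply_eq_norm {L : Type*} [TopologicalSpace L] [CompactSpace L]
    [Nonempty L] (f : C(L, ℝ)) : ∃ s, |f s| = ‖f‖ := by
  obtain ⟨s, -, hs⟩ := isCompact_univ.exists_isMaxOn univ_nonempty
    (f := fun u => |f u|) (by fun_prop)
  refine ⟨s, le_antisymm (f.norm_coe_le_norm s) ?_⟩
  exact (f.norm_le (abs_nonneg _)).2 fun u => hs (mem_univ u)

/-- A C-rich subspace contains uniform approximations of bump functions of height one supported in
any prescribed nonempty open set. -/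
theorem IsCRich.exists_approx_bump (hX : IsCRich X) {U : Set K} (hU : IsOpen U)
    (hne : U.Nonempty) {ε : ℝ} (hε : 0 < ε) :
    ∃ h : C(K, ℝ), ∃ g ∈ X, ∃ s ∈ U, h s = 1 ∧ (∀ u, 0 ≤ h u ∧ h u ≤ 1) ∧
      (∀ u, u ∉ U → h u = 0) ∧ ∀ u, |g u - h u| < ε := by
  obtain ⟨h, h0, h1, hs, hd⟩ := hX U hU hne ε hε
  have : Nonempty K := hne.to_type
  obtain ⟨g, hg, hgd⟩ := (Metric.infDist_lt_iff ⟨0, X.zero_mem⟩).1 hd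
  have hpos : ∀ u, 0 ≤ h u := fun u => h0 u
  obtain ⟨s, hsn⟩ := h.exists_abs_apply_eq_norm
  rw [h1, abs_of_nonneg (hpos s)] at hsn
  have hzero : ∀ u, u ∉ U → h u = 0 := fun u hu =>
    image_eq_zero_of_notMem_tsupport fun hu' => hu (hs hu')
  refine ⟨h, g, hg, s, ?_, hsn, fun u => ⟨hpos u, ?_⟩, hzero, fun u => ?_⟩
  · by_contra hsU
    rw [hzero s hsU] at hsn
    exact zero_ne_one hsn
  · exact (h.apply_le_norm u).trans h1.le
  · rw [dist_comm, dist_eq_norm] at hgd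
    exact ((g - h).norm_coe_le_norm u).trans_lt hgd

/-! ### Pushing two elements towards the sphere at a common point -/

theorem abs_add_mul_bump_lt_one {η c a h g v : ℝ} (hη : 0 < η) (hc : 0 ≤ c) (hc1 : c ≤ 1 - η)
    (ha : a = 1 - c - η / 2) (h0 : 0 ≤ h) (h1 : h ≤ 1) (hg : |g - h| < η / 8)
    (hv : |v| ≤ 1 - η) (hor : |v - c| < η / 8 ∨ h = 0) : |v + a * g| < 1 := by
  have ha0 : 0 ≤ a := by linarith
  have ha1 : a ≤ 1 := by linarith
  have hag : |a * (g - h)| ≤ η / 8 := by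
    rw [abs_mul, abs_of_nonneg ha0]
    nlinarith [abs_nonneg (g - h)]
  have hah0 : 0 ≤ a * h := mul_nonneg ha0 h0
  have hah1 : a * h ≤ a := mul_le_of_le_one_right ha0 h1
  rw [abs_le] at hag hv
  have e : v + a * g = v + a * h + a * (g - h) := by ring
  rw [e, abs_lt]
  -- Near `c`, `v + a * h ≤ c + η / 8 + a = 1 - 3 * η / 8`, which leaves room for the error `η / 8`.
  -- Where `h = 0`, the slack `η` in `hv` absorbs it.
  rcases hor with hor | rfl
  · rw [abs_lt] at hor
    constructor <;> linarith
  · constructor <;> linarith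

theorem lt_add_mul_bump {η c a g v : ℝ} (hη : 0 < η) (hc : 0 ≤ c) (hc1 : c ≤ 1 - η)
    (ha : a = 1 - c - η / 2) (hg : |g - 1| < η / 8) (hv : |v - c| < η / 8) :
    1 - η < v + a * g := by
  have ha0 : 0 ≤ a := by linarith
  have ha1 : a ≤ 1 := by linarith
  rw [abs_lt] at hg hv
  nlinarith

/-- Two elements of the open unit ball of a C-rich subspace that are both close to `1` at a common
point can be modified slightly so as to be even closer to `1` at a common point. -/
theorem IsCRich.exists_improvement (hX : IsCRich X) {x y : C(K, ℝ)} (hx : x ∈ X) (hy : y ∈ X)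
    (hx1 : ‖x‖ < 1) (hy1 : ‖y‖ < 1) {s : K} {δ δ' : ℝ} (hδ : δ ≤ 1) (hδ' : 0 < δ')
    (hxs : 1 - δ < x s) (hys : 1 - δ < y s) :
    ∃ x' ∈ X, ∃ y' ∈ X, ∃ s' : K, ‖x'‖ < 1 ∧ ‖y'‖ < 1 ∧ 1 - δ' < x' s' ∧ 1 - δ' < y' s' ∧
      ‖x' - x‖ ≤ 2 * δ ∧ ‖y' - y‖ ≤ 2 * δ := by
  obtain ⟨η, hη, hηδ, hηx, hηy⟩ : ∃ η : ℝ, 0 < η ∧ η ≤ δ' ∧ η ≤ 1 - ‖x‖ ∧ η ≤ 1 - ‖y‖ :=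
    ⟨min δ' (min (1 - ‖x‖) (1 - ‖y‖)), by simp [hδ', hx1, hy1], min_le_left _ _,
      (min_le_right _ _).trans (min_le_left _ _), (min_le_right _ _).trans (min_le_right _ _)⟩
  have hη1 : η ≤ 1 := by linarith [norm_nonneg x]
  have hU : IsOpen ({u | |x u - x s| < η / 8} ∩ {u | |y u - y s| < η / 8}) :=
    (isOpen_lt (by fun_prop) (by fun_prop)).inter (isOpen_lt (by fun_prop) (by fun_prop))
  obtain ⟨h, g, hg, s', hs', hhs', h01, hh0, hgh⟩ :=
    hX.exists_approx_bump hU ⟨s, by simp [hη], by simp [hη]⟩ (by positivity : 0 < η / 8)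
  have key : ∀ z ∈ X, η ≤ 1 - ‖z‖ → 1 - δ < z s → |z s' - z s| < η / 8 →
      (∀ u, |z u - z s| < η / 8 ∨ h u = 0) →
      ∃ z' ∈ X, ‖z'‖ < 1 ∧ 1 - δ' < z' s' ∧ ‖z' - z‖ ≤ 2 * δ := by
    intro z hz hηz hzs hzs' hor
    have hz1 : ∀ u, |z u| ≤ 1 - η := fun u => (z.norm_coe_le_norm u).trans (by linarith)
    have hc : 0 ≤ z s := by linarith
    have hc1 : z s ≤ 1 - η := (le_abs_self _).trans (hz1 s)
    -- The coefficient aims at height `1 - η / 2` at `s'`; it is less than `δ`, and `‖g‖ ≤ 2`.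
    refine ⟨z + (1 - z s - η / 2) • g, X.add_mem hz (X.smul_mem _ hg), ?_, ?_, ?_⟩
    · refine (ContinuousMap.norm_lt_iff _ one_pos).2 fun u => ?_
      exact abs_add_mul_bump_lt_one hη hc hc1 rfl (h01 u).1 (h01 u).2 (hgh u) (hz1 u) (hor u)
    · have := hgh s'
      rw [hhs'] at this
      have := lt_add_mul_bump hη hc hc1 rfl this hzs'
      simp only [ContinuousMap.add_apply, ContinuousMap.smul_apply, smul_eq_mul]
      linarith
    · have hgn : ‖g‖ ≤ 2 := (ContinuousMap.norm_le _ zero_le_two).2 fun u => by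
        have h1 := abs_lt.1 (hgh u)
        have h2 := h01 u
        rw [Real.norm_eq_abs, abs_le]
        constructor <;> linarith
      rw [add_sub_cancel_left, norm_smul, Real.norm_eq_abs, abs_of_nonneg (by linarith)]
      nlinarith [norm_nonneg g]
  have hmem : ∀ u, h u ≠ 0 → |x u - x s| < η / 8 ∧ |y u - y s| < η / 8 := fun u hu =>
    not_imp_comm.1 (hh0 u) hu
  obtain ⟨x', hx'X, hx'1, hx's, hx'd⟩ := key x hx hηx hxs hs'.1 fun u =>
    or_iff_not_imp_right.2 fun hu => (hmem u hu).1
  obtain ⟨y', hy'X, hy'1, hy's, hy'd⟩ := key y hy hηy hys hs'.2 fun u =>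
    or_iff_not_imp_right.2 fun hu => (hmem u hu).2
  exact ⟨x', hx'X, y', hy'X, s', hx'1, hy'1, hx's, hy's, hx'd, hy'd⟩

/-- In a closed C-rich subspace, two elements of the open unit ball that nearly attain the value `1`
at a common point are near elements of the closed unit ball whose sum has norm at least two. -/
theorem IsCRich.exists_norm_add_ge_two (hX : IsCRich X) (hcl : IsClosed (X : Set C(K, ℝ)))
    {x y : C(K, ℝ)} (hx : x ∈ X) (hy : y ∈ X) (hx1 : ‖x‖ < 1) (hy1 : ‖y‖ < 1) {s : K} {δ : ℝ}
    (hδ0 : 0 < δ) (hδ : δ ≤ 1) (hxs : 1 - δ < x s) (hys : 1 - δ < y s) :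
    ∃ x' ∈ X, ∃ y' ∈ X, ‖x'‖ ≤ 1 ∧ ‖y'‖ ≤ 1 ∧ 2 ≤ ‖x' + y'‖ ∧
      dist x x' ≤ 4 * δ ∧ dist y y' ≤ 4 * δ := by
  -- The common point may change with `n` and need not converge: only the norm of the sum passes to
  -- the limit.
  let P : ℕ → C(K, ℝ) × C(K, ℝ) → Prop := fun n p => p.1 ∈ X ∧ p.2 ∈ X ∧ ‖p.1‖ < 1 ∧ ‖p.2‖ < 1 ∧
    ∃ s, 1 - δ / 2 ^ n < p.1 s ∧ 1 - δ / 2 ^ n < p.2 s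
  have hle : ∀ n : ℕ, δ / 2 ^ n ≤ 1 := fun n =>
    (div_le_self hδ0.le (one_le_pow₀ one_le_two)).trans hδ
  have step : ∀ n p, P n p → ∃ q, P (n + 1) q ∧ dist p.1 q.1 ≤ 2 * (δ / 2 ^ n) ∧
      dist p.2 q.2 ≤ 2 * (δ / 2 ^ n) := by
    rintro n ⟨x, y⟩ ⟨hx, hy, hx1, hy1, s, hxs, hys⟩
    obtain ⟨x', hx', y', hy', s', h1, h2, h3, h4, h5, h6⟩ :=
      hX.exists_improvement hx hy hx1 hy1 (hle n) (by positivity : 0 < δ / 2 ^ (n + 1)) hxs hys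
    exact ⟨(x', y'), ⟨hx', hy', h1, h2, s', h3, h4⟩, by rwa [dist_comm, dist_eq_norm],
      by rwa [dist_comm, dist_eq_norm]⟩
  choose! F hFP hF1 hF2 using step
  let p : ℕ → C(K, ℝ) × C(K, ℝ) := fun n => Nat.rec (x, y) F n
  have hp : ∀ n, P n (p n) := by
    intro n
    induction n with
    | zero => exact ⟨hx, hy, hx1, hy1, s, by simpa [p] using hxs, by simpa [p] using hys⟩
    | succ n ih => exact hFP n _ ih
  -- The steps `2 * δ / 2 ^ n` sum to `4 * δ`.
  have hd1 : ∀ n, dist (p n).1 (p (n + 1)).1 ≤ 4 * δ / 2 / 2 ^ n := fun n =>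
    (hF1 n _ (hp n)).trans_eq (by ring)
  have hd2 : ∀ n, dist (p n).2 (p (n + 1)).2 ≤ 4 * δ / 2 / 2 ^ n := fun n =>
    (hF2 n _ (hp n)).trans_eq (by ring)
  obtain ⟨x', hx'⟩ := cauchySeq_tendsto_of_complete (cauchySeq_of_le_geometric_two hd1)
  obtain ⟨y', hy'⟩ := cauchySeq_tendsto_of_complete (cauchySeq_of_le_geometric_two hd2)
  refine ⟨x', hcl.mem_of_tendsto hx' (.of_forall fun n => (hp n).1), y',
    hcl.mem_of_tendsto hy' (.of_forall fun n => (hp n).2.1),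
    le_of_tendsto hx'.norm (.of_forall fun n => (hp n).2.2.1.le),
    le_of_tendsto hy'.norm (.of_forall fun n => (hp n).2.2.2.1.le), ?_,
    dist_le_of_le_geometric_two_of_tendsto₀ hd1 hx',
    dist_le_of_le_geometric_two_of_tendsto₀ hd2 hy'⟩
  have hlim : Tendsto (fun n : ℕ => 2 - 2 * (δ * (1 / 2) ^ n)) atTop (𝓝 2) := by
    simpa using ((tendsto_pow_atTop_nhds_zero_of_lt_one (r := (1 / 2 : ℝ)) (by norm_num)
      (by norm_num)).const_mul δ).const_mul 2 |>.const_sub 2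
  refine le_of_tendsto_of_tendsto' hlim (hx'.add hy').norm fun n => ?_
  obtain ⟨s, h1, h2⟩ := (hp n).2.2.2.2
  have h3 := ((p n).1 + (p n).2).apply_le_norm s
  rw [ContinuousMap.add_apply] at h3
  have h4 : δ / 2 ^ n = δ * (1 / 2) ^ n := by rw [one_div, inv_pow, div_eq_mul_inv]
  rw [h4] at h1 h2
  linarith

/-! ### Failure of strict convexity -/

theorem IsCRich.not_strictConvexSpace (hX : IsCRich X) (hcl : IsClosed (X : Set C(K, ℝ)))
    {U V : Set K} (hU : IsOpen U) (hV : IsOpen V) (hUn : U.Nonempty) (hVn : V.Nonempty)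
    (hUV : Disjoint U V) : ¬ StrictConvexSpace ℝ X := by
  intro hsc
  obtain ⟨h₁, g₁, hg₁, s, hs, hhs, h₁01, h₁0, hgh₁⟩ :=
    hX.exists_approx_bump hU hUn (ε := 1 / 200) (by norm_num)
  obtain ⟨h₂, g₂, hg₂, t, ht, hht, h₂01, h₂0, hgh₂⟩ :=
    hX.exists_approx_bump hV hVn (ε := 1 / 200) (by norm_num)
  have hor : ∀ u, h₁ u = 0 ∨ h₂ u = 0 := fun u => or_iff_not_imp_left.2 fun hu =>
    h₂0 u (hUV.notMem_of_mem_left (not_imp_comm.1 (h₁0 u) hu))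
  have bound : ∀ u, |99 / 100 * g₁ u| < 1 ∧ |99 / 100 * (g₁ u + g₂ u)| < 1 := by
    intro u
    have a₁ := h₁01 u
    have a₂ := h₂01 u
    have b₁ := abs_lt.1 (hgh₁ u)
    have b₂ := abs_lt.1 (hgh₂ u)
    rw [abs_lt, abs_lt]
    rcases hor u with e | e <;> refine ⟨⟨?_, ?_⟩, ?_, ?_⟩ <;> linarith
  have hs₂ : h₂ s = 0 := (hor s).resolve_left (by simp [hhs])
  have c₁ := abs_lt.1 (hgh₁ s)
  have c₂ := abs_lt.1 (hgh₂ s)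
  have c₃ := abs_lt.1 (hgh₂ t)
  rw [hhs] at c₁
  rw [hs₂] at c₂
  rw [hht] at c₃
  -- The factor `99 / 100` puts both elements in the open ball. With `δ = 1 / 32` each moves by at
  -- most `1 / 8`, too little to close their gap at `t`, about `0.98`.
  obtain ⟨x, hx, y, hy, hx1, hy1, hxy, hdx, hdy⟩ :=
    hX.exists_norm_add_ge_two hcl (x := (99 / 100 : ℝ) • g₁) (y := (99 / 100 : ℝ) • (g₁ + g₂))
      (X.smul_mem _ hg₁) (X.smul_mem _ (X.add_mem hg₁ hg₂))
      ((ContinuousMap.norm_lt_iff _ one_pos).2 fun u => (bound u).1)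
      ((ContinuousMap.norm_lt_iff _ one_pos).2 fun u => (bound u).2)
      (s := s) (δ := 1 / 32) (by norm_num) (by norm_num)
      (by simp only [ContinuousMap.smul_apply, smul_eq_mul]; linarith)
      (by simp only [ContinuousMap.smul_apply, ContinuousMap.add_apply, smul_eq_mul]; linarith)
  have hle := norm_add_le x y
  have heq : (⟨x, hx⟩ : X) = ⟨y, hy⟩ := by
    apply eq_of_norm_eq_of_norm_add_eq
    · change ‖x‖ = ‖y‖
      linarith
    · change ‖x + y‖ = ‖x‖ + ‖y‖
      linarith
  obtain rfl : x = y := congrArg Subtype.val heq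
  have hd := (dist_triangle_right _ _ x).trans (add_le_add hdx hdy)
  have hdt := (ContinuousMap.dist_apply_le_dist t).trans hd
  rw [Real.dist_eq] at hdt
  simp only [ContinuousMap.smul_apply, ContinuousMap.add_apply, smul_eq_mul] at hdt
  linarith [(abs_le.1 hdt).1]

/-! ### Failure of smoothness -/

theorem IsCRich.not_isSmoothNormedSpace (hX : IsCRich X) {A B : Set K} (hA : IsClosed A)
    (hB : IsClosed B) (hAB : A ∪ B = univ) (hAn : Aᶜ.Nonempty) (hBn : Bᶜ.Nonempty) :
    ¬ IsSmoothNormedSpace X := by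
  intro hsm
  obtain ⟨h₁, g₁, hg₁, s, hs, hhs, h₁01, h₁0, hgh₁⟩ :=
    hX.exists_approx_bump hB.isOpen_compl hBn (ε := 1 / 8) (by norm_num)
  obtain ⟨h₂, g₂, hg₂, t, ht, hht, h₂01, h₂0, hgh₂⟩ :=
    hX.exists_approx_bump hA.isOpen_compl hAn (ε := 1 / 8) (by norm_num)
  have hcover : ∀ u, u ∈ A ∨ u ∈ B := fun u => by
    rw [← mem_union, hAB]
    trivial
  have hsA : s ∈ A := (hcover s).resolve_right hs
  have htB : t ∈ B := (hcover t).resolve_left ht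
  have hg₁B : ∀ u ∈ B, |g₁ u| ≤ 1 / 8 := fun u hu => by
    simpa [h₁0 u (not_not_intro hu)] using (hgh₁ u).le
  have hg₂A : ∀ u ∈ A, |g₂ u| ≤ 1 / 8 := fun u hu => by
    simpa [h₂0 u (not_not_intro hu)] using (hgh₂ u).le
  have hg₁s : 7 / 8 < g₁ s := by
    have := (abs_lt.1 (hgh₁ s)).1
    linarith
  have hg₂t : 7 / 8 < g₂ t := by
    have := (abs_lt.1 (hgh₂ t)).1
    linarith
  have : CompactSpace A := isCompact_iff_compactSpace.1 hA.isCompact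
  have : CompactSpace B := isCompact_iff_compactSpace.1 hB.isCompact
  have : Nonempty A := ⟨⟨s, hsA⟩⟩
  have : Nonempty B := ⟨⟨t, htB⟩⟩
  let x : unitInterval → C(K, ℝ) := fun r => (1 - r : ℝ) • g₁ + (r : ℝ) • g₂
  have hx : Continuous x := by fun_prop
  obtain ⟨r, hr⟩ : ∃ r, ‖(x r).restrict A‖ = ‖(x r).restrict B‖ := by
    refine intermediate_value_univ₂ (a := 1) (b := 0)
      ((ContinuousMap.continuous_restrict A).comp hx).norm
      ((ContinuousMap.continuous_restrict B).comp hx).norm ?_ ?_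
    · have e : x 1 = g₂ := by simp [x]
      rw [e]
      have h1 : ‖g₂.restrict A‖ ≤ 1 / 8 :=
        (ContinuousMap.norm_le _ (by norm_num)).2 fun u => hg₂A u u.2
      have h2 : g₂ t ≤ ‖g₂.restrict B‖ := (g₂.restrict B).apply_le_norm ⟨t, htB⟩
      linarith
    · have e : x 0 = g₁ := by simp [x]
      rw [e]
      have h1 : ‖g₁.restrict B‖ ≤ 1 / 8 :=
        (ContinuousMap.norm_le _ (by norm_num)).2 fun u => hg₁B u u.2
      have h2 : g₁ s ≤ ‖g₁.restrict A‖ := (g₁.restrict A).apply_le_norm ⟨s, hsA⟩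
      linarith
  have hr0 := r.2.1
  have hr1 := r.2.2
  have hxX : x r ∈ X := X.add_mem (X.smul_mem _ hg₁) (X.smul_mem _ hg₂)
  have hxu : ∀ u, x r u = (1 - r) * g₁ u + r * g₂ u := fun u => rfl
  obtain ⟨a, ha⟩ := ((x r).restrict A).exists_abs_apply_eq_norm
  obtain ⟨b, hb⟩ := ((x r).restrict B).exists_abs_apply_eq_norm
  have hab : |x r a| = |x r b| := ha.trans (hr.trans hb.symm)
  have hxa : |x r a| = ‖x r‖ := by
    refine le_antisymm ((x r).norm_coe_le_norm _) ?_
    refine (ContinuousMap.norm_le _ (abs_nonneg _)).2 fun u => ?_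
    rcases hcover u with hu | hu
    · exact (((x r).restrict A).norm_coe_le_norm ⟨u, hu⟩).trans_eq ha.symm
    · exact (((x r).restrict B).norm_coe_le_norm ⟨u, hu⟩).trans_eq (hb.symm.trans hab.symm)
  have hxb : |x r b| = ‖x r‖ := hab.symm.trans hxa
  -- The values at `s` and `t` add up to at least `7 / 8 - 1 / 8`, so one of them is at least `3 /
  -- 8`.
  have hlow : 3 / 8 ≤ ‖x r‖ := by
    have h1 := (x r).apply_le_norm s
    have h2 := (x r).apply_le_norm t
    rw [hxu] at h1 h2
    have h3 := (abs_le.1 (hg₁B t htB)).1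
    have h4 := (abs_le.1 (hg₂A s hsA)).1
    have h5 := mul_le_mul_of_nonneg_left hg₁s.le (sub_nonneg.2 hr1)
    have h6 := mul_le_mul_of_nonneg_left hg₂t.le hr0
    have h7 := mul_le_mul_of_nonneg_left h3 (sub_nonneg.2 hr1)
    have h8 := mul_le_mul_of_nonneg_left h4 hr0
    linarith
  have hx0 : x r ≠ 0 := norm_pos_iff.1 (by linarith)
  have k₁ : |g₁ a| ≤ 1 / 8 :=
    (abs_apply_eq_of_isSmoothNormedSpace hsm hxX hg₁ hx0 hxa hxb).trans_le (hg₁B b b.2)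
  have k₂ : |g₂ a| ≤ 1 / 8 := hg₂A a a.2
  have hup : |x r a| ≤ 1 / 8 := by
    rw [abs_le] at k₁ k₂ ⊢
    rw [hxu]
    constructor <;> nlinarith
  linarith

end CRich

theorem corollary4p7 (X : Submodule ℝ C(unitInterval, ℝ))
    (hclosed : IsClosed (X : Set C(unitInterval, ℝ))) (hrich : IsCRich X) :
    ¬ StrictConvexSpace ℝ X ∧ ¬ IsSmoothNormedSpace X := by
  let m : unitInterval := ⟨1 / 2, by norm_num, by norm_num⟩
  have h0 : (0 : unitInterval) < m := Subtype.mk_lt_mk.2 (by norm_num)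
  have h1 : m < (1 : unitInterval) := Subtype.mk_lt_mk.2 (by norm_num)
  constructor
  · exact hrich.not_strictConvexSpace hclosed (isOpen_Iio (a := m)) (isOpen_Ioi (a := m))
      ⟨0, h0⟩ ⟨1, h1⟩ (Set.disjoint_left.2 fun u (hu : u < m) (hu' : m < u) => lt_asymm hu hu')
  · exact hrich.not_isSmoothNormedSpace (isClosed_Iic (a := m)) (isClosed_Ici (a := m))
      Iic_union_Ici ⟨1, by simpa using h1⟩ ⟨0, by simpa using h0⟩
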